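/- Fix countably infinite sets of concept names, role names, variables and abstraction levels. A role is a role name $r$ or an inverse role $r^-$. $\mathcal{ALCI}$-concepts are built by $C,D ::= \top \mid A \mid \neg C \mid C \sqcap D \mid C \sqcup D \mid \exists R.C \mid \forall R.C$ with $A$ a concept name and $R$ a role; $\mathcal{EL}$-concepts use only $\top$, concept names, $\sqcap$ and $\exists r.C$ with $r$ a role name. A conjunctive query (CQ) $q(\bar x)=\exists \bar y\,\varphi(\bar x,\bar y)$ has as $\varphi$ a finite conjunction of atoms $C(x)$ and $r(x,y)$, with $C$ a concept and $r$ a role name; its answer variables $\bar x$ are pairwise distinct and each occurs in some atom; the variables $\bar y$ are quantified. A tuple $\bar d$ is an answer to $q$ on an interpretation if some map of the variables to the domain sends $\bar x$ to $\bar d$ and makes all atoms true. A CQ is connected if its graph (nodes: all its answer and quantified variables; edges: its role atoms) is connected. An A-interpretation consists of a set $\mathbf A_{\mathcal I}$ of abstraction levels; a relation $\prec$ on it such that the directed graph with an edge from $L'$ to $L$ whenever $L\prec L'$ is a rooted tree; a classical interpretation $\mathcal I_L$ with non-empty domain for each $L\in\mathbf A_{\mathcal I}$, the domains being pairwise disjoint;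 and a partial function $\rho$ which maps pairs $(d,L)$, with $d$ in the domain of some $\mathcal I_{L'}$ with $L\prec L'$, to non-empty finite tuples $\rho_L(d)$ over the domain of $\mathcal I_L$, such that for every $d$ in the domain of any $\mathcal I_L$ there is at most one $e$ for which $d$ occurs in $\rho_L(e)$. It satisfies - a concept inclusion $C\sqsubseteq_L D$ if $L\in\mathbf A_{\mathcal I}$ and $C^{\mathcal I_L}\subseteq D^{\mathcal I_L}$; - a concept refinement "$L{:}q(\bar x)$ refines $L'{:}C$" if $L\prec L'$ and for every $d\in C^{\mathcal I_{L'}}$, $\rho_L(d)$ is defined and is an answer to $q$ on $\mathcal I_L$; - a concept abstraction "$L'{:}C$ abstracts $L{:}q(\bar x)$" (with $q$ connected) if $L\prec L'$ and for every answer $\bar e$ to $q$ on $\mathcal I_L$ there is $d\in C^{\mathcal I_{L'}}$ with $\rho_L(d)=\bar e$; - a role refinement "$L{:}q(\bar x,\bar y)$ refines $L'{:}C_1(x)\wedge R(x,y)\wedge C_2(y)$" if $L\prec L'$ and for all $(d_1,d_2)\in R^{\mathcal I_{L'}}$ with $d_1\in C_1^{\mathcal I_{L'}}$ and $d_2\in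 C_2^{\mathcal I_{L'}}$, $\rho_L(d_1)$ and $\rho_L(d_2)$ are defined and $(\rho_L(d_1),\rho_L(d_2))$ is an answer to $q$ on $\mathcal I_L$. Let $\mathcal{ALCI}^{\mathsf{abs}}[\mathrm{ca},\mathrm{cr}]$-ontologies with quantified variables be the finite sets of concept inclusions, concept abstractions and concept refinements in which all concepts are $\mathcal{ALCI}$-concepts and all CQs $q$ may have quantified variables, and let $\mathcal{EL}^{\mathsf{abs}}[\mathrm{ca},\mathrm{cr},\mathrm{rr}]$-ontologies with quantified variables be the finite sets of concept inclusions, concept abstractions, concept refinements and role refinements in which all concepts are $\mathcal{EL}$-concepts, the role $R$ in role refinements is a role name, and all CQs $q$ may have quantified variables. Satisfiability is the problem to decide, given such an ontology $\mathcal O$, a concept $C$ of the same base logic ($\mathcal{ALCI}$ or $\mathcal{EL}$) and an abstraction level $L$, whether there is an A-interpretation $\mathcal I$ that satisfies all statements of $\mathcal O$ and has $L\in\mathbf A_{\mathcal I}$ and $C^{\mathcal I_L}\neq\emptyset$. **Theorem.** With quantified variables, satisfiability is undecidable in $\mathcal{ALCI}^{\mathsf{abs}}[\mathrm{ca},\mathrm{cr}]$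 and in $\mathcal{EL}^{\mathsf{abs}}[\mathrm{ca},\mathrm{cr},\mathrm{rr}]$. -/

import Mathlib

namespace AbsDL

/-! ### Syntax -/

/-- Concept names (a countably infinite set). -/
abbrev ConceptName := ℕ

/-- Role names (a countably infinite set). -/
abbrev RoleName := ℕ

/-- Variables of conjunctive queries (a countably infinite set). -/
abbrev Var := ℕ

/-- Abstraction levels (a countably infinite set). -/
abbrev Level := ℕ

/-- A role: a role name `r` or an inverse role `r⁻`. -/
inductive Role : Type
  | name (r : RoleName)
  | inv (r : RoleName)

/-- `ALCI`-concepts. `top` is kept as a constructor, since it is also available in `EL`. -/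
inductive Concept : Type
  | top
  | name (A : ConceptName)
  | neg (C : Concept)
  | inf (C D : Concept)
  | sup (C D : Concept)
  | ex (R : Role) (C : Concept)
  | all (R : Role) (C : Concept)

/-- `R` is a role name (not an inverse role). -/
def Role.IsName : Role → Prop
  | .name _ => True
  | .inv _ => False

/-- `EL`-concepts: no negation, disjunction, value restriction or inverse role. -/
def Concept.IsEL : Concept → Prop
  | .top => True
  | .name _ => True
  | .neg _ => False
  | .inf C D => C.IsEL ∧ D.IsEL
  | .sup _ _ => False
  | .ex R C => R.IsName ∧ C.IsEL
  | .all _ _ => False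

/-- Atoms `C(x)` and `r(x, y)`, with `r` a role name. -/
inductive Atom : Type
  | concept (C : Concept) (x : Var)
  | role (r : RoleName) (x y : Var)

/-- The variables of an atom. -/
def Atom.vars : Atom → Set Var
  | .concept _ x => {x}
  | .role _ x y => {x, y}

/-- A conjunctive query: the tuple of its answer variables and its atoms. All other variables
in the atoms are (existentially) quantified. -/
structure CQ where
  ans : List Var
  atoms : List Atom

/-- A conjunctive query `q(x̄, ȳ)` whose answer tuple is split into two parts. -/
structure CQ₂ where
  ansX : List Var
  ansY : List Var
  atoms : List Atom

/-- The conjunctive query `q(x̄ȳ)`, forgetting how the answer tuple is split. -/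
def CQ₂.toCQ (q : CQ₂) : CQ := ⟨q.ansX ++ q.ansY, q.atoms⟩

/-- The set of all (answer and quantified) variables. -/
def CQ.vars (q : CQ) : Set Var := {v | v ∈ q.ans ∨ ∃ a ∈ q.atoms, v ∈ a.vars}

/-- The answer variables are distinct, and each of them occurs in some atom. -/
def CQ.WellFormed (q : CQ) : Prop :=
  q.ans.Nodup ∧ ∀ v ∈ q.ans, ∃ a ∈ q.atoms, v ∈ a.vars

/-- The undirected graph on `var(q)` whose edges are the `{v, v'}` with `r(v, v') ∈ q` for some
role name `r` (loops are irrelevant for connectedness). -/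
def CQ.graph (q : CQ) : SimpleGraph q.vars :=
  SimpleGraph.fromRel fun v w => ∃ r, Atom.role r v.1 w.1 ∈ q.atoms

/-- The query is connected. -/
def CQ.IsConnected (q : CQ) : Prop := q.graph.Connected

/-- The statements of `ALCHI` with abstraction and refinement, without the requirement that the
conjunctive queries are full. -/
inductive Stmt : Type
  /-- `C ⊑_L D` -/
  | ci (L : Level) (C D : Concept)
  /-- `R ⊑_L S` -/
  | ri (L : Level) (R S : Role)
  /-- `L:q(x̄) refines L':C` -/
  | cr (L : Level) (q : CQ) (L' : Level) (C : Concept)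
  /-- `L':C abstracts L:q(x̄)` -/
  | ca (L' : Level) (C : Concept) (L : Level) (q : CQ)
  /-- `L:q(x̄, ȳ) refines L':(C₁(x) ∧ R(x, y) ∧ C₂(y))` -/
  | rr (L : Level) (q : CQ₂) (L' : Level) (C₁ : Concept) (R : Role) (C₂ : Concept)
  /-- `L':R abstracts L:q(x̄, ȳ)` -/
  | ra (L' : Level) (R : Role) (L : Level) (q : CQ₂)

/-- An ontology is a finite set of statements, presented as a list. -/
abbrev Ontology := List Stmt

/-! ### Fragments -/

/-- A fragment: which concepts and roles the base DL has, whether it has role inclusions, and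
which of the four kinds of abstraction and refinement statements are admitted. -/
structure Fragment where
  concept : Concept → Prop
  role : Role → Prop
  hasRI : Prop
  hasCR : Prop
  hasCA : Prop
  hasRR : Prop
  hasRA : Prop

/-- All concepts in the query belong to the base DL (its roles are always role names). -/
def CQ.Over (q : CQ) (F : Fragment) : Prop :=
  ∀ C x, Atom.concept C x ∈ q.atoms → F.concept C

/-- The statement is a legal statement of the fragment, extended with quantified variables.
Queries in abstraction statements have to be connected. -/
def Stmt.InFragment (F : Fragment) : Stmt → Prop
  | .ci _ C D => F.concept C ∧ F.concept D
  | .ri _ R S => F.hasRI ∧ F.role R ∧ F.role S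
  | .cr _ q _ C => F.hasCR ∧ q.WellFormed ∧ q.Over F ∧ F.concept C
  | .ca _ C _ q => F.hasCA ∧ q.WellFormed ∧ q.Over F ∧ q.IsConnected ∧ F.concept C
  | .rr _ q _ C₁ R C₂ => F.hasRR ∧ q.toCQ.WellFormed ∧ q.toCQ.Over F ∧
      F.concept C₁ ∧ F.role R ∧ F.concept C₂
  | .ra _ R _ q => F.hasRA ∧ q.toCQ.WellFormed ∧ q.toCQ.Over F ∧ q.toCQ.IsConnected ∧ F.role R

/-- `ALCI^abs[ca, cr]`: all `ALCI`-concepts, no role inclusions, concept abstraction and concept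
refinement. -/
def ALCI_ca_cr : Fragment where
  concept := fun _ => True
  role := fun _ => True
  hasRI := False
  hasCR := True
  hasCA := True
  hasRR := False
  hasRA := False

/-- `EL^abs[ca, cr, rr]`: `EL`-concepts, role names only, no role inclusions, concept abstraction,
concept refinement and role refinement. -/
def EL_ca_cr_rr : Fragment where
  concept := Concept.IsEL
  role := Role.IsName
  hasRI := False
  hasCR := True
  hasCA := True
  hasRR := True
  hasRA := False

/-! ### Semantics -/

/-- A classical DL interpretation with domain `Δ`. -/
structure Interp (Δ : Type) where
  nonempty : Nonempty Δ
  conceptName : ConceptName → Set Δ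
  roleName : RoleName → Set (Δ × Δ)

section
variable {Δ : Type}

/-- The extension of a role. -/
def Interp.role (I : Interp Δ) : Role → Set (Δ × Δ)
  | .name r => I.roleName r
  | .inv r => {p | (p.2, p.1) ∈ I.roleName r}

/-- The extension of a concept. -/
def Interp.concept (I : Interp Δ) : Concept → Set Δ
  | .top => Set.univ
  | .name A => I.conceptName A
  | .neg C => (I.concept C)ᶜ
  | .inf C D => I.concept C ∩ I.concept D
  | .sup C D => I.concept C ∪ I.concept D
  | .ex R C => {d | ∃ e, (d, e) ∈ I.role R ∧ e ∈ I.concept C}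
  | .all R C => {d | ∀ e, (d, e) ∈ I.role R → e ∈ I.concept C}

/-- An atom holds under a variable assignment. -/
def Atom.Holds (I : Interp Δ) (h : Var → Δ) : Atom → Prop
  | .concept C x => h x ∈ I.concept C
  | .role r x y => (h x, h y) ∈ I.roleName r

/-- The answers to a query. (Domains are non-empty, so that it makes no difference whether a
homomorphism is defined on `var(q)` only or on all variables.) -/
def CQ.answers (q : CQ) (I : Interp Δ) : Set (List Δ) :=
  {e | ∃ h : Var → Δ, (∀ a ∈ q.atoms, a.Holds I h) ∧ q.ans.map h = e}

/-- The answers to a query with a split answer tuple. -/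
def CQ₂.answers (q : CQ₂) (I : Interp Δ) : Set (List Δ × List Δ) :=
  {e | ∃ h : Var → Δ, (∀ a ∈ q.atoms, a.Holds I h) ∧ q.ansX.map h = e.1 ∧ q.ansY.map h = e.2}

end

/-- `(V, {(v', v) | prec v v'})` is a (directed, rooted) tree: there is a root, which has no
parent, every node can be reached from the root, and no node has more than one parent. -/
def IsTree {V : Type} (prec : V → V → Prop) : Prop :=
  (∃ root : V, (∀ v, ¬ prec root v) ∧ ∀ v, Relation.ReflTransGen (fun a b => prec b a) root v) ∧
  ∀ v a b, prec v a → prec v b → a = b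

/-- A-interpretations. The domains are the members of a family of types indexed by the relevant
levels, hence disjoint. -/
structure AInterp where
  /-- the relevant abstraction levels -/
  levels : Set Level
  /-- `prec L L'`: the level `L` is less abstract than `L'` -/
  prec : levels → levels → Prop
  isTree : IsTree prec
  Dom : levels → Type
  interp : (L : levels) → Interp (Dom L)
  /-- the refinement function: `ρ d L` for `d` in the domain of level `K` -/
  ρ : {K : levels} → Dom K → (L : levels) → Option (List (Dom L))
  ρ_prec : ∀ {K L : levels} (d : Dom K) (e : List (Dom L)), ρ d L = some e → prec L K
  ρ_nonempty : ∀ {K L : levels} (d : Dom K) (e : List (Dom L)), ρ d L = some e → e ≠ []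
  /-- every object participates in at most one ensemble -/
  ρ_unique : ∀ {L K K' : levels} (d : Dom L) (e : Dom K) (e' : Dom K') (t t' : List (Dom L)),
    ρ e L = some t → d ∈ t → ρ e' L = some t' → d ∈ t' →
      (⟨K, e⟩ : (K : levels) × Dom K) = ⟨K', e'⟩

/-- An A-interpretation satisfies a statement. -/
def AInterp.Sat (I : AInterp) : Stmt → Prop
  | .ci L C D => ∃ hL : L ∈ I.levels,
      (I.interp ⟨L, hL⟩).concept C ⊆ (I.interp ⟨L, hL⟩).concept D
  | .ri L R S => ∃ hL : L ∈ I.levels,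
      (I.interp ⟨L, hL⟩).role R ⊆ (I.interp ⟨L, hL⟩).role S
  | .cr L q L' C => ∃ (hL : L ∈ I.levels) (hL' : L' ∈ I.levels), I.prec ⟨L, hL⟩ ⟨L', hL'⟩ ∧
      ∀ d ∈ (I.interp ⟨L', hL'⟩).concept C,
        ∃ e ∈ q.answers (I.interp ⟨L, hL⟩), I.ρ d ⟨L, hL⟩ = some e
  | .ca L' C L q => ∃ (hL : L ∈ I.levels) (hL' : L' ∈ I.levels), I.prec ⟨L, hL⟩ ⟨L', hL'⟩ ∧
      ∀ e ∈ q.answers (I.interp ⟨L, hL⟩),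
        ∃ d ∈ (I.interp ⟨L', hL'⟩).concept C, I.ρ d ⟨L, hL⟩ = some e
  | .rr L q L' C₁ R C₂ =>
      ∃ (hL : L ∈ I.levels) (hL' : L' ∈ I.levels), I.prec ⟨L, hL⟩ ⟨L', hL'⟩ ∧
      ∀ d₁ d₂, d₁ ∈ (I.interp ⟨L', hL'⟩).concept C₁ → (d₁, d₂) ∈ (I.interp ⟨L', hL'⟩).role R →
        d₂ ∈ (I.interp ⟨L', hL'⟩).concept C₂ →
        ∃ e₁ e₂, (e₁, e₂) ∈ q.answers (I.interp ⟨L, hL⟩) ∧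
          I.ρ d₁ ⟨L, hL⟩ = some e₁ ∧ I.ρ d₂ ⟨L, hL⟩ = some e₂
  | .ra L' R L q => ∃ (hL : L ∈ I.levels) (hL' : L' ∈ I.levels), I.prec ⟨L, hL⟩ ⟨L', hL'⟩ ∧
      ∀ e₁ e₂, (e₁, e₂) ∈ q.answers (I.interp ⟨L, hL⟩) →
        ∃ d₁ d₂, (d₁, d₂) ∈ (I.interp ⟨L', hL'⟩).role R ∧
          I.ρ d₁ ⟨L, hL⟩ = some e₁ ∧ I.ρ d₂ ⟨L, hL⟩ = some e₂

/-- `I` is a model of the ontology. -/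
def AInterp.IsModel (I : AInterp) (O : Ontology) : Prop := ∀ s ∈ O, I.Sat s

/-- An input of the satisfiability problem: an ontology, a concept and an abstraction level. -/
abbrev Input := Ontology × Concept × Level

/-- `C` is `L`-satisfiable w.r.t. `O`, for the input `(O, C, L)`. -/
def Satisfiable (x : Input) : Prop :=
  ∃ I : AInterp, I.IsModel x.1 ∧
    ∃ hL : x.2.2 ∈ I.levels, ((I.interp ⟨x.2.2, hL⟩).concept x.2.1).Nonempty

/-- The inputs of the satisfiability problem for a fragment: the ontology and the concept belong to
the fragment. -/
def Fragment.IsInput (F : Fragment) (x : Input) : Prop :=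
  (∀ s ∈ x.1, s.InFragment F) ∧ F.concept x.2.1

/-! ### Encoding of the syntax, and undecidability -/

/-- Roles as natural numbers. -/
def Role.equivSum : Role ≃ ℕ ⊕ ℕ where
  toFun
    | .name r => .inl r
    | .inv r => .inr r
  invFun
    | .inl r => .name r
    | .inr r => .inv r
  left_inv := by rintro (_ | _) <;> rfl
  right_inv := by rintro (_ | _) <;> rfl

/-- Roles as natural numbers. -/
def Role.equivNat : Role ≃ ℕ := Role.equivSum.trans Equiv.natSumNatEquivNat

/-- Gödel numbers of concepts. -/
def Concept.toNat : Concept → ℕ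
  | .top => 0
  | .name A => 6 * A + 1
  | .neg C => 6 * C.toNat + 2
  | .inf C D => 6 * Nat.pair C.toNat D.toNat + 3
  | .sup C D => 6 * Nat.pair C.toNat D.toNat + 4
  | .ex R C => 6 * Nat.pair (Role.equivNat R) C.toNat + 5
  | .all R C => 6 * Nat.pair (Role.equivNat R) C.toNat + 6

/-- The concept with a given Gödel number. -/
def Concept.ofNat : ℕ → Concept
  | 0 => .top
  | n + 1 =>
    have h : n / 6 < n + 1 := by omega
    have h1 : (n / 6).unpair.1 < n + 1 := (Nat.unpair_left_le _).trans_lt h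
    have h2 : (n / 6).unpair.2 < n + 1 := (Nat.unpair_right_le _).trans_lt h
    match n % 6 with
    | 0 => .name (n / 6)
    | 1 => .neg (Concept.ofNat (n / 6))
    | 2 => .inf (Concept.ofNat (n / 6).unpair.1) (Concept.ofNat (n / 6).unpair.2)
    | 3 => .sup (Concept.ofNat (n / 6).unpair.1) (Concept.ofNat (n / 6).unpair.2)
    | 4 => .ex (Role.equivNat.symm (n / 6).unpair.1) (Concept.ofNat (n / 6).unpair.2)
    | _ => .all (Role.equivNat.symm (n / 6).unpair.1) (Concept.ofNat (n / 6).unpair.2)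

theorem Concept.ofNat_toNat (C : Concept) : Concept.ofNat C.toNat = C := by
  induction C with
  | top => simp [toNat, ofNat]
  | name A => simp [toNat, ofNat]
  | neg C ih =>
    have h1 : (6 * C.toNat + 1) % 6 = 1 := by omega
    have h2 : (6 * C.toNat + 1) / 6 = C.toNat := by omega
    rw [toNat, ofNat]; simp [h1, h2, ih]
  | inf C D ih ih' =>
    have h1 : (6 * Nat.pair C.toNat D.toNat + 2) % 6 = 2 := by omega
    have h2 : (6 * Nat.pair C.toNat D.toNat + 2) / 6 = Nat.pair C.toNat D.toNat := by omega
    rw [toNat, ofNat]; simp [h1, h2, ih, ih']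
  | sup C D ih ih' =>
    have h1 : (6 * Nat.pair C.toNat D.toNat + 3) % 6 = 3 := by omega
    have h2 : (6 * Nat.pair C.toNat D.toNat + 3) / 6 = Nat.pair C.toNat D.toNat := by omega
    rw [toNat, ofNat]; simp [h1, h2, ih, ih']
  | ex R C ih =>
    have h1 : (6 * Nat.pair (Role.equivNat R) C.toNat + 4) % 6 = 4 := by omega
    have h2 : (6 * Nat.pair (Role.equivNat R) C.toNat + 4) / 6
      = Nat.pair (Role.equivNat R) C.toNat := by omega
    rw [toNat, ofNat]; simp [h1, h2, ih]
  | all R C ih =>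
    have h1 : (6 * Nat.pair (Role.equivNat R) C.toNat + 5) % 6 = 5 := by omega
    have h2 : (6 * Nat.pair (Role.equivNat R) C.toNat + 5) / 6
      = Nat.pair (Role.equivNat R) C.toNat := by omega
    rw [toNat, ofNat]; simp [h1, h2, ih]

theorem Concept.toNat_ofNat (n : ℕ) : (Concept.ofNat n).toNat = n := by
  induction n using Nat.strong_induction_on with
  | _ n ih =>
    match n with
    | 0 => simp [toNat, ofNat]
    | n + 1 =>
      have h : n / 6 < n + 1 := by omega
      have i0 := ih _ h
      have i1 := ih _ ((Nat.unpair_left_le (n / 6)).trans_lt h)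
      have i2 := ih _ ((Nat.unpair_right_le (n / 6)).trans_lt h)
      have hm : n % 6 = 0 ∨ n % 6 = 1 ∨ n % 6 = 2 ∨ n % 6 = 3 ∨ n % 6 = 4 ∨ n % 6 = 5 := by omega
      rw [ofNat]
      rcases hm with hm | hm | hm | hm | hm | hm <;>
        simp only [hm, toNat, i0, i1, i2, Equiv.apply_symm_apply, Nat.pair_unpair] <;> omega

/-- The Gödel numbering of concepts, as a bijection. -/
def Concept.equivNat : Concept ≃ ℕ where
  toFun := Concept.toNat
  invFun := Concept.ofNat
  left_inv := Concept.ofNat_toNat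
  right_inv := Concept.toNat_ofNat

/-- Atoms as tuples. -/
def Atom.equivSum : Atom ≃ (Concept × Var) ⊕ (RoleName × Var × Var) where
  toFun
    | .concept C x => .inl (C, x)
    | .role r x y => .inr (r, x, y)
  invFun
    | .inl (C, x) => .concept C x
    | .inr (r, x, y) => .role r x y
  left_inv := by rintro (_ | _) <;> rfl
  right_inv := by rintro (⟨_, _⟩ | ⟨_, _, _⟩) <;> rfl

/-- Queries as tuples. -/
def CQ.equivProd : CQ ≃ List Var × List Atom where
  toFun q := (q.ans, q.atoms)
  invFun p := ⟨p.1, p.2⟩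
  left_inv _ := rfl
  right_inv _ := rfl

/-- Queries with a split answer tuple as tuples. -/
def CQ₂.equivProd : CQ₂ ≃ List Var × List Var × List Atom where
  toFun q := (q.ansX, q.ansY, q.atoms)
  invFun p := ⟨p.1, p.2.1, p.2.2⟩
  left_inv _ := rfl
  right_inv _ := rfl

/-- Statements as tuples. -/
def Stmt.equivSum : Stmt ≃
    (Level × Concept × Concept) ⊕ (Level × Role × Role) ⊕ (Level × CQ × Level × Concept) ⊕
    (Level × Concept × Level × CQ) ⊕ (Level × CQ₂ × Level × Concept × Role × Concept) ⊕
    (Level × Role × Level × CQ₂) where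
  toFun
    | .ci L C D => .inl (L, C, D)
    | .ri L R S => .inr (.inl (L, R, S))
    | .cr L q L' C => .inr (.inr (.inl (L, q, L', C)))
    | .ca L' C L q => .inr (.inr (.inr (.inl (L', C, L, q))))
    | .rr L q L' C₁ R C₂ => .inr (.inr (.inr (.inr (.inl (L, q, L', C₁, R, C₂)))))
    | .ra L' R L q => .inr (.inr (.inr (.inr (.inr (L', R, L, q)))))
  invFun
    | .inl (L, C, D) => .ci L C D
    | .inr (.inl (L, R, S)) => .ri L R S
    | .inr (.inr (.inl (L, q, L', C))) => .cr L q L' C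
    | .inr (.inr (.inr (.inl (L', C, L, q)))) => .ca L' C L q
    | .inr (.inr (.inr (.inr (.inl (L, q, L', C₁, R, C₂))))) => .rr L q L' C₁ R C₂
    | .inr (.inr (.inr (.inr (.inr (L', R, L, q))))) => .ra L' R L q
  left_inv := by rintro (_ | _ | _ | _ | _ | _) <;> rfl
  right_inv := by rintro (_ | _ | _ | _ | _ | _) <;> rfl

instance : Primcodable Role := Primcodable.ofEquiv ℕ Role.equivNat

instance : Primcodable Concept := Primcodable.ofEquiv ℕ Concept.equivNat

instance : Primcodable Atom := Primcodable.ofEquiv _ Atom.equivSum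

instance : Primcodable CQ := Primcodable.ofEquiv _ CQ.equivProd

instance : Primcodable CQ₂ := Primcodable.ofEquiv _ CQ₂.equivProd

instance : Primcodable Stmt := Primcodable.ofEquiv _ Stmt.equivSum

/-- The problem `P`, restricted to the inputs in `D`, is undecidable: there is no algorithm (no
partial recursive function, which may do anything outside `D`) that terminates on every input in
`D` and tells whether it satisfies `P`. -/
def UndecidableOn {α : Type} [Primcodable α] (D P : α → Prop) : Prop :=
  ¬ ∃ f : α →. Bool, Partrec f ∧ ∀ x, D x → ∃ b ∈ f x, (b = true ↔ P x)

end AbsDL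

namespace AbsDL

/-! ### Stack machines -/

/-! The halting problem for stack machines reduces to unsatisfiability, using only `EL`-concepts,
concept inclusions and concept abstractions, so one reduction serves both fragments.

Quantified variables let a concept abstraction force equalities. `pairQuery` makes every edge `(x,
y)` of `pairRole` an ensemble. If another abstraction also makes `[x', y]` an ensemble, then `x =
x'`, since `y` lies in at most one ensemble. Queries whose quantified variables follow push edges up
to a pair edge thus make pushing functional (`functional`) and make pushes on different stacks
commute (`commute`). Hence the product of the free monoids over the stacks acts on the elements
labelled `dom`, and an `init` element yields an element `conf x S` for every stack content `S`.
Different contents may be represented by the same element. This is harmless, because the inclusions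
only propagate positive labels: along a run, `conf x S` receives the label of each state reached
with `S` (`conf_mem_of_reach`). An element with the halting label would form a singleton ensemble as
well as a pair, which is impossible (`not_mem_halt`). So a satisfiable input excludes halting
(`not_reach_of_satisfiable`).

Conversely, if the machine does not halt, the stack contents themselves form a model, with a second,
unlabelled copy of each serving as its partner (`satisfiable_of_not_reach`).

The machine is a fixed one of type `TM2` that evaluates a partial recursive function on the inputs
`2 ^ m`. The binary form of such an input is a run of zeros and a final one, so the ontology is
constant and the input concept is essentially an `m`-fold iterate. -/

/-- Instructions of a machine with stacks indexed by `κ` over the stack alphabet `γ` and with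
states in `Q`. -/
inductive Instr (κ γ Q : Type) : Type
  /-- in state `p`, push `a` on the stack `k` and go to state `p'` -/
  | push (p : Q) (k : κ) (a : γ) (p' : Q)
  /-- in state `p`, pop `a` from the stack `k` and go to state `p'` -/
  | pop (p : Q) (k : κ) (a : γ) (p' : Q)
  /-- in state `p`, if the top symbol of the stack `k` is `o`, go to state `p'` -/
  | test (p : Q) (k : κ) (o : Option γ) (p' : Q)
  /-- in state `p`, go to state `p'` -/
  | jump (p p' : Q)
  deriving Fintype

/-- The configurations (state and stacks) that are reachable from the state `p₀` and the
stacks `S₀`. -/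
inductive Reach {κ γ Q : Type} [DecidableEq κ] (P : Set (Instr κ γ Q)) (p₀ : Q)
    (S₀ : κ → List γ) : Q → (κ → List γ) → Prop
  | refl : Reach P p₀ S₀ p₀ S₀
  | push {p k a p' S} : Reach P p₀ S₀ p S → Instr.push p k a p' ∈ P →
      Reach P p₀ S₀ p' (Function.update S k (a :: S k))
  | pop {p k a p' S} : Reach P p₀ S₀ p (Function.update S k (a :: S k)) →
      Instr.pop p k a p' ∈ P → Reach P p₀ S₀ p' S
  | test {p k o p' S} : Reach P p₀ S₀ p S → Instr.test p k o p' ∈ P → (S k).head? = o →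
      Reach P p₀ S₀ p' S
  | jump {p p' S} : Reach P p₀ S₀ p S → Instr.jump p p' ∈ P → Reach P p₀ S₀ p' S

/-! ### Concept names and role names -/

/-- What the concept names express about a configuration of the stacks. -/
inductive Label (κ γ Q : Type) : Type
  /-- this is a configuration of the stacks -/
  | dom
  /-- all stacks are empty -/
  | init
  /-- the top symbol of the stack `k` is `o` -/
  | top (k : κ) (o : Option γ)
  /-- the machine reaches this configuration in state `p` -/
  | state (p : Q)
  deriving Fintype

/-- An injective numbering of a finite type. -/
noncomputable def num {α : Type} [Finite α] (a : α) : ℕ := (Finite.equivFin α a).1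

theorem num_injective {α : Type} [Finite α] : Function.Injective (num (α := α)) :=
  fun _ _ h => (Finite.equivFin α).injective (Fin.ext h)

section
variable {κ γ Q : Type} [Finite κ] [Finite γ] [Finite Q]

instance : Finite (Label κ γ Q) := by
  classical
  have := Fintype.ofFinite κ
  have := Fintype.ofFinite γ
  have := Fintype.ofFinite Q
  infer_instance

instance : Finite (Instr κ γ Q) := by
  classical
  have := Fintype.ofFinite κ
  have := Fintype.ofFinite γ
  have := Fintype.ofFinite Q
  infer_instance

/-- The concept name of a label. -/
noncomputable def Label.concept (l : Label κ γ Q) : Concept := .name (num l)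

/-- The role name for pushing `g.2` on the stack `g.1`. -/
noncomputable def pushRole (g : κ × γ) : RoleName := num (some g)

variable (κ γ) in
/-- The role name that links the two members of an ensemble. -/
noncomputable def pairRole : RoleName := num (none : Option (κ × γ))

variable (Q) in
/-- After pushing `g.2` on the stack `g.1`, a configuration in `C` is obtained. -/
noncomputable def exPush (g : κ × γ) (C : Concept) : Concept :=
  .ex (.name (pushRole g)) (.inf (Label.dom : Label κ γ Q).concept C)

/-! ### The ontology -/

variable (κ γ) in
/-- The pairs that form an ensemble. -/
noncomputable def pairQuery : CQ := ⟨[0, 1], [.role (pairRole κ γ) 0 1]⟩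

/-- Pairs that have to be ensembles if pushing is functional. -/
noncomputable def functionalQuery (g : κ × γ) : CQ :=
  ⟨[0, 1], [.role (pushRole g) 2 0, .role (pushRole g) 2 3, .role (pairRole κ γ) 3 1]⟩

/-- Pairs that have to be ensembles if pushing on two stacks commutes. -/
noncomputable def commuteQuery (g h : κ × γ) : CQ :=
  ⟨[0, 1], [.role (pushRole g) 2 3, .role (pushRole h) 3 0, .role (pushRole h) 2 4,
    .role (pushRole g) 4 5, .role (pairRole κ γ) 5 1]⟩

/-- The instances of a concept. -/
def instanceQuery (C : Concept) : CQ := ⟨[0], [.concept C 0]⟩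

/-- The concept inclusion that describes an instruction. -/
noncomputable def Instr.stmt : Instr κ γ Q → Stmt
  | .push p k a p' => .ci 0 (Label.state p : Label κ γ Q).concept
      (exPush Q (k, a) (Label.state p' : Label κ γ Q).concept)
  | .pop p k a p' => .ci 0 (.ex (.name (pushRole (k, a))) (Label.state p : Label κ γ Q).concept)
      (Label.state p' : Label κ γ Q).concept
  | .test p k o p' => .ci 0
      (.inf (Label.state p : Label κ γ Q).concept (Label.top k o : Label κ γ Q).concept)
      (Label.state p' : Label κ γ Q).concept
  | .jump p p' => .ci 0 (Label.state p : Label κ γ Q).concept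
      (Label.state p' : Label κ γ Q).concept

/-- The statements that hold in the intended model if the machine with program `P` does not reach
the state `h`. -/
inductive MachineStmt (P : Set (Instr κ γ Q)) (h : Q) : Stmt → Prop
  | pair : MachineStmt P h (.ca 1 .top 0 (pairQuery κ γ))
  | halt : MachineStmt P h (.ca 1 .top 0 (instanceQuery (Label.state h : Label κ γ Q).concept))
  | functional (g : κ × γ) : MachineStmt P h (.ca 1 .top 0 (functionalQuery g))
  | commute (g g' : κ × γ) : g.1 ≠ g'.1 → MachineStmt P h (.ca 1 .top 0 (commuteQuery g g'))
  | dom_pair : MachineStmt P h (.ci 0 (Label.dom : Label κ γ Q).concept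
      (.ex (.name (pairRole κ γ)) .top))
  | dom_push (g : κ × γ) : MachineStmt P h (.ci 0 (Label.dom : Label κ γ Q).concept
      (exPush Q g (Label.top g.1 (some g.2) : Label κ γ Q).concept))
  | init_dom : MachineStmt P h (.ci 0 (Label.init : Label κ γ Q).concept
      (Label.dom : Label κ γ Q).concept)
  | init_top (k : κ) : MachineStmt P h (.ci 0 (Label.init : Label κ γ Q).concept
      (Label.top k none : Label κ γ Q).concept)
  | top_push (g : κ × γ) (k : κ) (o : Option γ) : g.1 ≠ k →
      MachineStmt P h (.ci 0 (Label.top k o : Label κ γ Q).concept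
        (exPush Q g (Label.top k o : Label κ γ Q).concept))
  | instr (i : Instr κ γ Q) : i ∈ P → MachineStmt P h i.stmt

theorem finite_machineStmt (P : Set (Instr κ γ Q)) (h : Q) : {s | MachineStmt P h s}.Finite := by
  -- A superset suffices: dropping the side conditions of `commute`, `top_push` and `instr` leaves
  -- singletons and ranges over finite types.
  have H : Set.Finite (({.ca 1 .top 0 (pairQuery κ γ),
      .ca 1 .top 0 (instanceQuery (Label.state h : Label κ γ Q).concept),
      .ci 0 (Label.dom : Label κ γ Q).concept (.ex (.name (pairRole κ γ)) .top),
      .ci 0 (Label.init : Label κ γ Q).concept (Label.dom : Label κ γ Q).concept} : Set Stmt)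
    ∪ Set.range (fun g : κ × γ => Stmt.ca 1 .top 0 (functionalQuery g))
    ∪ Set.range (fun g : (κ × γ) × (κ × γ) => Stmt.ca 1 .top 0 (commuteQuery g.1 g.2))
    ∪ Set.range (fun g : κ × γ => Stmt.ci 0 (Label.dom : Label κ γ Q).concept
        (exPush Q g (Label.top g.1 (some g.2) : Label κ γ Q).concept))
    ∪ Set.range (fun k : κ => Stmt.ci 0 (Label.init : Label κ γ Q).concept
        (Label.top k none : Label κ γ Q).concept)
    ∪ Set.range (fun x : (κ × γ) × κ × Option γ =>
        Stmt.ci 0 (Label.top x.2.1 x.2.2 : Label κ γ Q).concept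
        (exPush Q x.1 (Label.top x.2.1 x.2.2 : Label κ γ Q).concept))
    ∪ Set.range (Instr.stmt : Instr κ γ Q → Stmt)) := by
    exact ((((((Set.toFinite _).union (Set.finite_range _)).union (Set.finite_range _)).union
      (Set.finite_range _)).union (Set.finite_range _)).union (Set.finite_range _)).union
      (Set.finite_range _)
  refine H.subset ?_
  rintro s (_ | _ | g | ⟨g, g', _⟩ | _ | g | _ | k | ⟨g, k, o, _⟩ | ⟨i, _⟩)
  · simp
  · simp
  · simp
  · simp only [Set.mem_union, Set.mem_range]
    exact .inl <| .inl <| .inl <| .inl <| .inr ⟨(g, g'), rfl⟩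
  · simp
  · simp
  · simp
  · simp
  · simp only [Set.mem_union, Set.mem_range]
    exact .inl <| .inr ⟨(g, k, o), rfl⟩
  · simp

/-- The ontology for a stack machine. -/
noncomputable def machineOntology (P : Set (Instr κ γ Q)) (h : Q) : Ontology :=
  (finite_machineStmt P h).toFinset.toList

theorem mem_machineOntology {P : Set (Instr κ γ Q)} {h : Q} {s : Stmt} :
    s ∈ machineOntology P h ↔ MachineStmt P h s := by
  simp [machineOntology]

variable (Q) in
/-- Pushing the word `w` on the stack `k`, last letter first, leads to a configuration in `C`. -/
noncomputable def exPushWord (k : κ) (w : List γ) (C : Concept) : Concept :=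
  w.foldl (fun D a => exPush Q (k, a) D) C

/-- The input concept for a machine that starts in state `p₀` with the word `w` on the stack `k`
while all other stacks are empty. -/
noncomputable def inputConcept (p₀ : Q) (k : κ) (w : List γ) : Concept :=
  .inf (Label.init : Label κ γ Q).concept
    (exPushWord Q k w (Label.state p₀ : Label κ γ Q).concept)

/-! ### The ontology belongs to the fragments -/

/-- The variables reachable from `v` are closed under role atoms in both directions, so they are one
of the sets `U`. Connectedness of a concrete query thus becomes a chase along its atoms. -/
theorem CQ.isConnected_of_closed {q : CQ} (v : Var) (hv : v ∈ q.vars)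
    (H : ∀ U : Set Var, v ∈ U → (∀ r x y, Atom.role r x y ∈ q.atoms → (x ∈ U ↔ y ∈ U)) →
      q.vars ⊆ U) : q.IsConnected := by
  have key : q.vars ⊆ {w | ∃ hw : w ∈ q.vars, q.graph.Reachable ⟨v, hv⟩ ⟨w, hw⟩} := by
    apply H
    · exact ⟨hv, .refl _⟩
    · intro r x y hr
      have hx : x ∈ q.vars := .inr ⟨_, hr, by simp [Atom.vars]⟩
      have hy : y ∈ q.vars := .inr ⟨_, hr, by simp [Atom.vars]⟩
      have hxy : q.graph.Reachable ⟨x, hx⟩ ⟨y, hy⟩ := by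
        by_cases h : x = y
        · subst h; exact .refl _
        · refine SimpleGraph.Adj.reachable ?_
          rw [CQ.graph, SimpleGraph.fromRel_adj]
          exact ⟨by simpa using h, .inl ⟨r, hr⟩⟩
      exact ⟨fun ⟨_, h⟩ => ⟨hy, h.trans hxy⟩, fun ⟨_, h⟩ => ⟨hx, h.trans hxy.symm⟩⟩
  refine (SimpleGraph.connected_iff_exists_forall_reachable _).2 ⟨⟨v, hv⟩, ?_⟩
  rintro ⟨w, hw⟩
  exact (key hw).2

theorem pairQuery_wellFormed : (pairQuery κ γ).WellFormed := by
  simp [pairQuery, CQ.WellFormed, Atom.vars]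

theorem functionalQuery_wellFormed (g : κ × γ) : (functionalQuery g).WellFormed := by
  simp [functionalQuery, CQ.WellFormed, Atom.vars]

theorem commuteQuery_wellFormed (g h : κ × γ) : (commuteQuery g h).WellFormed := by
  simp [commuteQuery, CQ.WellFormed, Atom.vars]

theorem instanceQuery_wellFormed (C : Concept) : (instanceQuery C).WellFormed := by
  simp [instanceQuery, CQ.WellFormed, Atom.vars]

theorem pairQuery_isConnected : (pairQuery κ γ).IsConnected := by
  refine CQ.isConnected_of_closed 0 (by simp [pairQuery, CQ.vars]) fun U h0 h => ?_
  have h1 := h (pairRole κ γ) 0 1 (by simp [pairQuery])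
  intro v hv
  simp [pairQuery, CQ.vars, Atom.vars] at hv
  rcases hv with rfl | rfl <;> tauto

theorem functionalQuery_isConnected (g : κ × γ) : (functionalQuery g).IsConnected := by
  refine CQ.isConnected_of_closed 0 (by simp [functionalQuery, CQ.vars]) fun U h0 h v hv => ?_
  have h2 := (h (pushRole g) 2 0 (by simp [functionalQuery])).2 h0
  have h3 := (h (pushRole g) 2 3 (by simp [functionalQuery])).1 h2
  have h1 := (h (pairRole κ γ) 3 1 (by simp [functionalQuery])).1 h3
  clear h
  simp [functionalQuery, CQ.vars, Atom.vars] at hv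
  rcases hv with (rfl | rfl) | (rfl | rfl) | (rfl | rfl) | rfl | rfl <;> assumption

theorem commuteQuery_isConnected (g g' : κ × γ) : (commuteQuery g g').IsConnected := by
  refine CQ.isConnected_of_closed 0 (by simp [commuteQuery, CQ.vars]) fun U h0 h v hv => ?_
  have h3 := (h (pushRole g') 3 0 (by simp [commuteQuery])).2 h0
  have h2 := (h (pushRole g) 2 3 (by simp [commuteQuery])).2 h3
  have h4 := (h (pushRole g') 2 4 (by simp [commuteQuery])).1 h2
  have h5 := (h (pushRole g) 4 5 (by simp [commuteQuery])).1 h4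
  have h1 := (h (pairRole κ γ) 5 1 (by simp [commuteQuery])).1 h5
  clear h
  simp [commuteQuery, CQ.vars, Atom.vars] at hv
  rcases hv with (rfl | rfl) | (rfl | rfl) | (rfl | rfl) | (rfl | rfl) | (rfl | rfl) | rfl | rfl <;>
    assumption

theorem instanceQuery_isConnected (C : Concept) : (instanceQuery C).IsConnected := by
  refine CQ.isConnected_of_closed 0 (by simp [instanceQuery, CQ.vars]) fun U h0 h => ?_
  intro v hv
  simp [instanceQuery, CQ.vars, Atom.vars] at hv
  exact hv ▸ h0

theorem Label.isEL_concept (l : Label κ γ Q) : l.concept.IsEL := trivial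

theorem isEL_exPush (g : κ × γ) {C : Concept} (hC : C.IsEL) : (exPush Q g C).IsEL :=
  ⟨trivial, Label.isEL_concept _, hC⟩

theorem isEL_exPushWord (k : κ) (w : List γ) {C : Concept} (hC : C.IsEL) :
    (exPushWord Q k w C).IsEL := by
  induction w generalizing C with
  | nil => exact hC
  | cons a w ih => exact ih (isEL_exPush _ hC)

/-- Stated for any fragment with `EL`-concepts and concept abstraction, so that it covers both cases
of the theorem. -/
theorem MachineStmt.inFragment {P : Set (Instr κ γ Q)} {h : Q} {s : Stmt} (hs : MachineStmt P h s)
    (F : Fragment) (hF : ∀ C : Concept, C.IsEL → F.concept C) (hca : F.hasCA) :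
    s.InFragment F := by
  have hT : F.concept .top := hF _ trivial
  have hL (l : Label κ γ Q) : F.concept l.concept := hF _ l.isEL_concept
  cases hs with
  | pair =>
    exact ⟨hca, pairQuery_wellFormed, by simp [CQ.Over, pairQuery], pairQuery_isConnected, hT⟩
  | halt =>
    refine ⟨hca, instanceQuery_wellFormed _, ?_, instanceQuery_isConnected _, hT⟩
    simp only [CQ.Over, instanceQuery, List.mem_singleton, Atom.concept.injEq]
    rintro _ _ ⟨rfl, _⟩
    exact hL _
  | functional g =>
    exact ⟨hca, functionalQuery_wellFormed g, by simp [CQ.Over, functionalQuery],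
      functionalQuery_isConnected g, hT⟩
  | commute g g' _ =>
    exact ⟨hca, commuteQuery_wellFormed g g', by simp [CQ.Over, commuteQuery],
      commuteQuery_isConnected g g', hT⟩
  | dom_pair => exact ⟨hL _, hF _ ⟨trivial, trivial⟩⟩
  | dom_push g => exact ⟨hL _, hF _ (isEL_exPush g (Label.isEL_concept _))⟩
  | init_dom => exact ⟨hL _, hL _⟩
  | init_top k => exact ⟨hL _, hL _⟩
  | top_push g k o _ => exact ⟨hL _, hF _ (isEL_exPush g (Label.isEL_concept _))⟩
  | instr i _ =>
    cases i with
    | push p k a p' => exact ⟨hL _, hF _ (isEL_exPush (k, a) (Label.isEL_concept _))⟩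
    | pop p k a p' => exact ⟨hF _ ⟨trivial, Label.isEL_concept _⟩, hL _⟩
    | test p k o p' => exact ⟨hF _ ⟨Label.isEL_concept _, Label.isEL_concept _⟩, hL _⟩
    | jump p p' => exact ⟨hL _, hL _⟩

theorem isInput_machineOntology (P : Set (Instr κ γ Q)) (h p₀ : Q) (k : κ) (w : List γ)
    (F : Fragment) (hF : ∀ C : Concept, C.IsEL → F.concept C) (hca : F.hasCA) :
    F.IsInput (machineOntology P h, inputConcept p₀ k w, 0) :=
  ⟨fun _ hs => (mem_machineOntology.1 hs).inFragment F hF hca,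
    hF _ ⟨Label.isEL_concept _, isEL_exPushWord k w (Label.isEL_concept _)⟩⟩

end

end AbsDL

namespace AbsDL

/-! ### Every model contains all configurations of the stacks -/

section
variable {κ γ Q : Type} [Fintype κ] [Finite γ] [Finite Q]

/-- The interpretation `J` of level `0`, with the set `E` of ensembles, satisfies the ontology of
a machine. -/
structure IsMachineModel (P : Set (Instr κ γ Q)) (h : Q) {Δ : Type} (J : Interp Δ)
    (E : Set (List Δ)) : Prop where
  unique : ∀ t ∈ E, ∀ t' ∈ E, ∀ d ∈ t, d ∈ t' → t = t'
  ca : ∀ q, MachineStmt P h (.ca 1 .top 0 q) → q.answers J ⊆ E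
  ci : ∀ C D, MachineStmt P h (.ci 0 C D) → J.concept C ⊆ J.concept D

namespace IsMachineModel

variable {P : Set (Instr κ γ Q)} {h : Q} {Δ : Type} {J : Interp Δ} {E : Set (List Δ)}

/-! ### Equalities forced by ensembles -/

theorem pair_mem (M : IsMachineModel P h J E) {x y : Δ}
    (hxy : (x, y) ∈ J.roleName (pairRole κ γ)) : [x, y] ∈ E := by
  refine M.ca _ .pair ⟨fun v => if v = 0 then x else y, ?_, by simp [pairQuery]⟩
  simp [pairQuery, Atom.Holds, hxy]

/-- Ensembles that share `y` coincide as lists, hence so do their first entries. Every forced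
equality rests on this. -/
theorem eq_of_pair_mem (M : IsMachineModel P h J E) {x x' y : Δ} (h₁ : [x, y] ∈ E)
    (h₂ : [x', y] ∈ E) : x = x' := by
  have := M.unique _ h₁ _ h₂ y (by simp) (by simp)
  simp_all

theorem exists_pair (M : IsMachineModel P h J E) {x : Δ}
    (hx : x ∈ J.concept (Label.dom : Label κ γ Q).concept) :
    ∃ y, (x, y) ∈ J.roleName (pairRole κ γ) := by
  obtain ⟨y, hy, _⟩ := M.ci _ _ .dom_pair hx
  exact ⟨y, hy⟩

/-- A partner `z` of `y'` yields the ensembles `[y, z]` and `[y', z]`. Only one of the two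
successors needs a partner. -/
theorem functional (M : IsMachineModel P h J E) {g : κ × γ} {x y y' : Δ}
    (hy' : y' ∈ J.concept (Label.dom : Label κ γ Q).concept)
    (h₁ : (x, y) ∈ J.roleName (pushRole g)) (h₂ : (x, y') ∈ J.roleName (pushRole g)) : y = y' := by
  obtain ⟨z, hz⟩ := M.exists_pair hy'
  refine M.eq_of_pair_mem (M.ca _ (.functional g)
    ⟨fun v => if v = 0 then y else if v = 1 then z else if v = 2 then x else y', ?_, ?_⟩)
    (M.pair_mem hz)
  · simp [functionalQuery, Atom.Holds, *]
  · simp [functionalQuery]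

theorem commute (M : IsMachineModel P h J E) {g g' : κ × γ} (hg : g.1 ≠ g'.1)
    {x y y' z z' : Δ}
    (hz' : z' ∈ J.concept (Label.dom : Label κ γ Q).concept)
    (h₁ : (x, y) ∈ J.roleName (pushRole g)) (h₂ : (y, z) ∈ J.roleName (pushRole g'))
    (h₃ : (x, y') ∈ J.roleName (pushRole g')) (h₄ : (y', z') ∈ J.roleName (pushRole g)) :
    z = z' := by
  obtain ⟨w, hw⟩ := M.exists_pair hz'
  refine M.eq_of_pair_mem (M.ca _ (.commute g g' hg)
    ⟨fun v => if v = 0 then z else if v = 1 then w else if v = 2 then x else if v = 3 then y else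
      if v = 4 then y' else z', ?_, ?_⟩) (M.pair_mem hw)
  · simp [commuteQuery, Atom.Holds, *]
  · simp [commuteQuery]

/-- The ensembles `[x]` and `[x, y]` share `x` but differ in length. -/
theorem not_mem_halt (M : IsMachineModel P h J E) {x : Δ}
    (hx : x ∈ J.concept (Label.dom : Label κ γ Q).concept) :
    x ∉ J.concept (Label.state h : Label κ γ Q).concept := by
  intro hx'
  obtain ⟨y, hy⟩ := M.exists_pair hx
  have h₁ : [x] ∈ E := by
    refine M.ca _ .halt ⟨fun _ => x, ?_, by simp [instanceQuery]⟩
    simpa [instanceQuery, Atom.Holds] using hx'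
  have := M.unique _ h₁ _ (M.pair_mem hy) x (by simp) (by simp)
  simp at this

/-! ### Stack contents acting on the elements of a model -/

/-- The elements that represent configurations of the stacks. -/
abbrev Conf (_ : IsMachineModel P h J E) : Type :=
  {x : Δ // x ∈ J.concept (Label.dom : Label κ γ Q).concept}

theorem exists_succ (M : IsMachineModel P h J E) (g : κ × γ) (x : M.Conf) :
    ∃ y : M.Conf, (x.1, y.1) ∈ J.roleName (pushRole g) := by
  obtain ⟨y, hy, hy', _⟩ := M.ci _ _ (.dom_push g) x.2
  exact ⟨⟨y, hy'⟩, hy⟩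

/-- The configuration after pushing `g.2` on the stack `g.1`. -/
noncomputable def succ (M : IsMachineModel P h J E) (g : κ × γ) (x : M.Conf) : M.Conf :=
  (M.exists_succ g x).choose

theorem succ_spec (M : IsMachineModel P h J E) (g : κ × γ) (x : M.Conf) :
    (x.1, (M.succ g x).1) ∈ J.roleName (pushRole g) :=
  (M.exists_succ g x).choose_spec

/-- The conjunct `dom` in `exPush` gives the witness a partner, so by functionality the witness is
the chosen successor. -/
theorem succ_mem_of_mem_exPush (M : IsMachineModel P h J E) {g : κ × γ} {x : M.Conf} {C : Concept}
    (hx : x.1 ∈ J.concept (exPush Q g C)) : (M.succ g x).1 ∈ J.concept C := by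
  obtain ⟨y, hy, hy', hC⟩ := hx
  rwa [M.functional hy' (M.succ_spec g x) hy]

/-- The effect of pushing a word on a stack. -/
noncomputable def act (M : IsMachineModel P h J E) (k : κ) :
    FreeMonoid γ →* Function.End M.Conf :=
  FreeMonoid.lift (M := Function.End M.Conf) fun a => M.succ (k, a)

theorem act_of (M : IsMachineModel P h J E) (k : κ) (a : γ) :
    M.act k (FreeMonoid.of a) = M.succ (k, a) :=
  FreeMonoid.lift_eval_of (M := Function.End M.Conf) _ _

theorem commute_act (M : IsMachineModel P h J E) :
    Pairwise fun k k' => ∀ v w, Commute (M.act k v) (M.act k' w) := by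
  intro k k' hk v w
  induction v using FreeMonoid.recOn with
  | one => simp
  | of_mul a v ih =>
    rw [map_mul]
    refine Commute.mul_left ?_ ih
    clear ih
    induction w using FreeMonoid.recOn with
    | one => simp
    | of_mul b w ih =>
      rw [map_mul]
      refine Commute.mul_right ?_ ih
      rw [act_of, act_of]
      refine funext fun x => Subtype.ext ?_
      -- Multiplication in `Function.End` is composition, so `(k', b)` is pushed first on the
      -- left-hand side.
      exact M.commute (g := (k', b)) (g' := (k, a)) (Ne.symm hk) (Subtype.prop _)
        (M.succ_spec _ _) (M.succ_spec _ _) (M.succ_spec _ _) (M.succ_spec _ _)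

/-- The effect of pushing words on all stacks. -/
noncomputable def actAll (M : IsMachineModel P h J E) :
    (κ → FreeMonoid γ) →* Function.End M.Conf :=
  MonoidHom.noncommPiCoprod M.act M.commute_act

/-- The element that represents the configuration `S` of the stacks if `x` represents the
configuration with empty stacks. -/
noncomputable def conf (M : IsMachineModel P h J E) (x : M.Conf) (S : κ → List γ) : M.Conf :=
  M.actAll (fun k => FreeMonoid.ofList (S k)) x

theorem conf_nil (M : IsMachineModel P h J E) (x : M.Conf) : M.conf x (fun _ => []) = x := by
  have : M.actAll (fun _ : κ => FreeMonoid.ofList ([] : List γ)) = 1 := map_one M.actAll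
  rw [conf, this]; rfl

variable [DecidableEq κ]

/-- The leftmost letter of a word acts last, in agreement with the head of the list being the top of
the stack. -/
theorem conf_push (M : IsMachineModel P h J E) (x : M.Conf) (S : κ → List γ) (k : κ) (a : γ) :
    M.conf x (Function.update S k (a :: S k)) = M.succ (k, a) (M.conf x S) := by
  have h₁ : (fun j => FreeMonoid.ofList (Function.update S k (a :: S k) j)) =
      Pi.mulSingle k (FreeMonoid.of a) * fun j => FreeMonoid.ofList (S j) := by
    funext j
    by_cases hj : j = k
    · subst hj; simp [FreeMonoid.ofList_cons]
    · simp [hj]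
  have h₂ : M.actAll (Pi.mulSingle k (FreeMonoid.of a)) = M.succ (k, a) := by
    rw [actAll, MonoidHom.noncommPiCoprod_mulSingle, act_of]
  rw [conf, h₁, map_mul, h₂]
  rfl

/-- As pushes on different stacks commute, stack `k` may be filled first. Its top is then known from
`init_top` or `dom_push`, and the pushes on the other stacks preserve it by `top_push`. -/
theorem conf_mem_top (M : IsMachineModel P h J E) {x : M.Conf}
    (hx : x.1 ∈ J.concept (Label.init : Label κ γ Q).concept) (k : κ) (S : κ → List γ) :
    (M.conf x S).1 ∈ J.concept (Label.top k (S k).head? : Label κ γ Q).concept := by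
  set T : κ → FreeMonoid γ := fun j => FreeMonoid.ofList (S j) with hT
  have hS : T = Function.update T k 1 * Pi.mulSingle k (T k) := by
    funext j
    by_cases hj : j = k
    · subst hj; simp
    · simp [hj]
  have h₁ : (M.act k (T k) x).1 ∈ J.concept (Label.top k (S k).head? : Label κ γ Q).concept := by
    simp only [hT]
    cases S k with
    | nil =>
      rw [FreeMonoid.ofList_nil, map_one]
      exact M.ci _ _ (.init_top k) hx
    | cons a l =>
      rw [FreeMonoid.ofList_cons, map_mul]
      exact M.succ_mem_of_mem_exPush (M.ci _ _ (.dom_push (k, a)) (Subtype.prop _))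
  -- The maps that preserve the top label form a submonoid, so it is enough to check the factors
  -- and, within each, single letters.
  let N (o : Option γ) : Submonoid (Function.End M.Conf) :=
    { carrier := {f | ∀ y : M.Conf, y.1 ∈ J.concept (Label.top k o : Label κ γ Q).concept →
        (f y).1 ∈ J.concept (Label.top k o : Label κ γ Q).concept}
      one_mem' := fun _ hy => hy
      mul_mem' := fun hf hg y hy => hf _ (hg y hy) }
  have h₂ : M.actAll (Function.update T k 1) ∈ N (S k).head? := by
    refine Submonoid.noncommProd_mem _ _ _ (fun i _ j _ hij => M.commute_act hij _ _) fun j _ => ?_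
    by_cases hj : j = k
    · subst hj
      simp
    · rw [Function.update_of_ne hj]
      induction T j using FreeMonoid.recOn with
      | one => simp
      | of_mul a v ih =>
        rw [map_mul]
        refine mul_mem (fun y hy => ?_) ih
        rw [act_of]
        exact M.succ_mem_of_mem_exPush (M.ci _ _ (.top_push (j, a) k _ hj) hy)
  have h₃ : M.conf x S = M.actAll (Function.update T k 1) (M.act k (T k) x) := by
    rw [conf, ← hT]
    conv_lhs => rw [hS]
    rw [map_mul, actAll, MonoidHom.noncommPiCoprod_mulSingle]
    rfl
  rw [h₃]
  exact h₂ _ h₁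

/-! ### Runs of the machine inside a model -/

/-- Each instruction has its inclusion: a push sends the new state forward along the functional push
role, a pop reads the old state at the push successor, which avoids inverse roles, and a test relies
on `conf_mem_top`. -/
theorem conf_mem_of_reach (M : IsMachineModel P h J E) {x : M.Conf}
    (hx : x.1 ∈ J.concept (Label.init : Label κ γ Q).concept) {p₀ : Q} {S₀ : κ → List γ}
    (h₀ : (M.conf x S₀).1 ∈ J.concept (Label.state p₀ : Label κ γ Q).concept) {p : Q}
    {S : κ → List γ} (hr : Reach P p₀ S₀ p S) :
    (M.conf x S).1 ∈ J.concept (Label.state p : Label κ γ Q).concept := by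
  induction hr with
  | refl => exact h₀
  | push _ hi ih =>
    rw [conf_push]
    exact M.succ_mem_of_mem_exPush (M.ci _ _ (.instr _ hi) ih)
  | pop _ hi ih =>
    rw [conf_push] at ih
    exact M.ci _ _ (.instr _ hi) ⟨_, M.succ_spec _ _, ih⟩
  | @test p k o p' S _ hi ho ih =>
    exact M.ci _ _ (.instr _ hi) ⟨ih, ho ▸ M.conf_mem_top hx k S⟩
  | jump _ hi ih => exact M.ci _ _ (.instr _ hi) ih

/-- The left fold puts the restriction for the last letter outermost, so that letter is pushed first
and the head of `w` ends up on top. -/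
theorem conf_mem_of_mem_exPushWord (M : IsMachineModel P h J E) {x : M.Conf} (k : κ) (w : List γ)
    {C : Concept} (hx : x.1 ∈ J.concept (exPushWord Q k w C)) :
    (M.conf x (Function.update (fun _ => []) k w)).1 ∈ J.concept C := by
  induction w generalizing C with
  | nil =>
    have : Function.update (fun _ : κ => ([] : List γ)) k [] = fun _ => [] := by simp
    rwa [this, conf_nil]
  | cons a w ih =>
    have h₁ := M.succ_mem_of_mem_exPush (ih hx)
    rw [← conf_push] at h₁
    simpa using h₁

theorem not_reach (M : IsMachineModel P h J E) {p₀ : Q} {k : κ} {w : List γ}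
    (hne : (J.concept (inputConcept p₀ k w : Concept)).Nonempty) (S : κ → List γ) :
    ¬ Reach P p₀ (Function.update (fun _ => []) k w) h S := by
  intro hr
  obtain ⟨x, hx, hw⟩ := hne
  let y : M.Conf := ⟨x, M.ci _ _ .init_dom hx⟩
  exact M.not_mem_halt (Subtype.prop _)
    (M.conf_mem_of_reach (x := y) hx (M.conf_mem_of_mem_exPushWord k w hw) hr)

end IsMachineModel

variable [DecidableEq κ]

theorem not_reach_of_satisfiable {P : Set (Instr κ γ Q)} {h p₀ : Q} {k : κ} {w : List γ}
    (hsat : Satisfiable (machineOntology P h, inputConcept p₀ k w, 0)) (S : κ → List γ) :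
    ¬ Reach P p₀ (Function.update (fun _ => []) k w) h S := by
  obtain ⟨I, hI, hL, hne⟩ := hsat
  have hI' (s : Stmt) (hs : MachineStmt P h s) : I.Sat s := hI s (mem_machineOntology.2 hs)
  refine IsMachineModel.not_reach (J := I.interp ⟨0, hL⟩)
    (E := {t | ∃ (K : I.levels) (d : I.Dom K), I.ρ d ⟨0, hL⟩ = some t}) ⟨?_, ?_, ?_⟩ hne S
  · rintro t ⟨K, d, hd⟩ t' ⟨K', d', hd'⟩ x hx hx'
    -- A shared object forces the same abstract element, and `ρ` assigns it only one tuple.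
    cases I.ρ_unique x d d' t t' hd hx hd' hx'
    simpa [hd] using hd'
  · intro q hq t ht
    obtain ⟨_, hL', _, H⟩ := hI' _ hq
    obtain ⟨d, _, hd⟩ := H t ht
    exact ⟨_, d, hd⟩
  · intro C D hCD
    exact (hI' _ hCD).2

end

end AbsDL

namespace AbsDL

/-! ### The intended model of a machine that does not halt -/

section
variable {κ γ Q : Type} [Finite κ] [DecidableEq κ] [Finite γ] [Finite Q]

/-- Pushing `g.2` on the stack `g.1`. -/
def pushConf (g : κ × γ) (S : κ → List γ) : κ → List γ := Function.update S g.1 (g.2 :: S g.1)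

omit [Finite κ] [Finite γ] in
theorem pushConf_comm {g g' : κ × γ} (h : g.1 ≠ g'.1) (S : κ → List γ) :
    pushConf g (pushConf g' S) = pushConf g' (pushConf g S) := by
  simp only [pushConf, Function.update_of_ne h, Function.update_of_ne h.symm]
  exact Function.update_comm h.symm _ _ _

/-- The label `l` applies to the configuration `S` of the stacks, for a machine which reaches the
pairs of states and stacks in `R`. -/
def Label.Holds (R : Q → (κ → List γ) → Prop) (S : κ → List γ) : Label κ γ Q → Prop
  | .dom => True
  | .init => S = fun _ => []
  | .top k o => (S k).head? = o
  | .state p => R p S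

/-- The interpretation whose elements are the configurations of the stacks, in two copies. -/
def confInterp (R : Q → (κ → List γ) → Prop) : Interp ((κ → List γ) × Bool) where
  nonempty := ⟨(fun _ => [], false)⟩
  conceptName c := {d | d.2 = false ∧ ∃ l : Label κ γ Q, num l = c ∧ l.Holds R d.1}
  roleName r := {d | d.1.2 = false ∧ ((r = pairRole κ γ ∧ d.2 = (d.1.1, true)) ∨
    ∃ g, r = pushRole g ∧ d.2 = (pushConf g d.1.1, false))}

variable {R : Q → (κ → List γ) → Prop}

theorem mem_confInterp_label {l : Label κ γ Q} {d : (κ → List γ) × Bool} :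
    d ∈ (confInterp R).concept l.concept ↔ d.2 = false ∧ l.Holds R d.1 := by
  simp [Label.concept, Interp.concept, confInterp, num_injective.eq_iff]

theorem mem_confInterp_pairRole {d e : (κ → List γ) × Bool} :
    (d, e) ∈ (confInterp R).roleName (pairRole κ γ) ↔ d.2 = false ∧ e = (d.1, true) := by
  simp [confInterp, pairRole, pushRole, num_injective.eq_iff]

theorem mem_confInterp_pushRole {g : κ × γ} {d e : (κ → List γ) × Bool} :
    (d, e) ∈ (confInterp R).roleName (pushRole g) ↔
      d.2 = false ∧ e = (pushConf g d.1, false) := by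
  simp [confInterp, pairRole, pushRole, num_injective.eq_iff, -Prod.exists]

theorem mem_confInterp_exPush {g : κ × γ} {C : Concept} {d : (κ → List γ) × Bool} :
    d ∈ (confInterp R).concept (exPush Q g C) ↔
      d.2 = false ∧ (pushConf g d.1, false) ∈ (confInterp R).concept C := by
  constructor
  · rintro ⟨e, he, -, hC⟩
    obtain ⟨h₁, rfl⟩ := mem_confInterp_pushRole.1 he
    exact ⟨h₁, hC⟩
  · rintro ⟨h₁, h₂⟩
    exact ⟨_, mem_confInterp_pushRole.2 ⟨h₁, rfl⟩, mem_confInterp_label.2 ⟨rfl, trivial⟩, h₂⟩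

theorem mem_confInterp_exPushWord {k : κ} {w : List γ} {C : Concept}
    (h : (Function.update (fun _ => []) k w, false) ∈ (confInterp R).concept C) :
    (fun _ => [], false) ∈ (confInterp R).concept (exPushWord Q k w C) := by
  induction w generalizing C with
  | nil => simpa [exPushWord] using h
  | cons a w ih =>
    refine ih (mem_confInterp_exPush.2 ⟨rfl, ?_⟩)
    simpa [pushConf] using h

/-- The A-interpretation with levels `0 ≺ 1` whose ensembles are the pairs of the two copies of a
configuration of the stacks. -/
noncomputable def confAInterp (R : Q → (κ → List γ) → Prop) : AInterp where
  levels := {0, 1}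
  prec L K := L.1 = 0 ∧ K.1 = 1
  isTree := by
    refine ⟨⟨⟨1, by simp⟩, by simp, ?_⟩, ?_⟩
    · rintro ⟨v, rfl | rfl⟩
      · exact .single ⟨rfl, rfl⟩
      · exact .refl
    · rintro _ a b ⟨_, ha⟩ ⟨_, hb⟩
      exact Subtype.ext (ha.trans hb.symm)
  Dom _ := (κ → List γ) × Bool
  interp _ := confInterp R
  -- Both levels use the same type. Only first copies at level `1` are refined; otherwise `(S,
  -- false)` and `(S, true)` would claim the same ensemble.
  ρ {K} d L := open Classical in
    if L.1 = 0 ∧ K.1 = 1 ∧ d.2 = false then some [(d.1, false), (d.1, true)] else none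
  ρ_prec := by
    intro K L d e h
    split_ifs at h with h'
    exact ⟨h'.1, h'.2.1⟩
  ρ_nonempty := by
    intro K L d e h
    split_ifs at h with h'
    cases h
    simp
  ρ_unique := by
    intro L K K' d e e' t t' h hd h' hd'
    split_ifs at h h' with h₁ h₂
    cases h
    cases h'
    have hK : K = K' := Subtype.ext (h₁.2.1.trans h₂.2.1.symm)
    subst hK
    obtain ⟨S, b⟩ := e
    obtain ⟨S', b'⟩ := e'
    have : S = S' := by aesop
    simp_all

/-- The abstract concept is `top`, so only the shape of the answers matters. -/
theorem sat_ca_confAInterp {q : CQ}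
    (h : ∀ t ∈ q.answers (confInterp R), ∃ S, t = [(S, false), (S, true)]) :
    (confAInterp R).Sat (.ca 1 .top 0 q) := by
  refine ⟨by simp [confAInterp], by simp [confAInterp], ⟨rfl, rfl⟩, fun t ht => ?_⟩
  obtain ⟨S, rfl⟩ := h t ht
  exact ⟨(S, false), trivial, by simp [confAInterp]⟩

theorem sat_ci_confAInterp {C D : Concept}
    (h : (confInterp R).concept C ⊆ (confInterp R).concept D) :
    (confAInterp R).Sat (.ci 0 C D) :=
  ⟨by simp [confAInterp], h⟩

/-- States label exactly the reachable configurations, so the inclusions for instructions are the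
closure rules of `Reach`. The query for halting has no answers, and the other queries only return a
configuration with its second copy. -/
theorem sat_machineStmt {P : Set (Instr κ γ Q)} {h p₀ : Q} {S₀ : κ → List γ}
    (hh : ∀ S, ¬ Reach P p₀ S₀ h S) {s : Stmt} (hs : MachineStmt P h s) :
    (confAInterp (Reach P p₀ S₀)).Sat s := by
  cases hs with
  | pair =>
    refine sat_ca_confAInterp ?_
    rintro _ ⟨v, hv, rfl⟩
    simp only [pairQuery, List.mem_singleton, forall_eq, Atom.Holds,
      mem_confInterp_pairRole] at hv
    exact ⟨(v 0).1, by simp [pairQuery, hv.2, Prod.ext_iff, hv.1]⟩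
  | halt =>
    refine sat_ca_confAInterp ?_
    rintro _ ⟨v, hv, rfl⟩
    simp only [instanceQuery, List.mem_singleton, forall_eq, Atom.Holds,
      mem_confInterp_label] at hv
    exact (hh _ hv.2).elim
  | functional g =>
    refine sat_ca_confAInterp ?_
    rintro _ ⟨v, hv, rfl⟩
    simp only [functionalQuery, List.forall_mem_cons, Atom.Holds, mem_confInterp_pairRole,
      mem_confInterp_pushRole] at hv
    obtain ⟨⟨_, h₁⟩, ⟨_, h₂⟩, ⟨_, h₃⟩, _⟩ := hv
    exact ⟨pushConf g (v 2).1, by simp [functionalQuery, h₁, h₂, h₃]⟩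
  | commute g g' hg =>
    refine sat_ca_confAInterp ?_
    rintro _ ⟨v, hv, rfl⟩
    simp only [commuteQuery, List.forall_mem_cons, Atom.Holds, mem_confInterp_pairRole,
      mem_confInterp_pushRole] at hv
    obtain ⟨⟨_, h₁⟩, ⟨_, h₂⟩, ⟨_, h₃⟩, ⟨_, h₄⟩, ⟨_, h₅⟩, _⟩ := hv
    exact ⟨pushConf g (pushConf g' (v 2).1),
      by simp [commuteQuery, h₁, h₂, h₃, h₄, h₅, pushConf_comm hg]⟩
  | dom_pair =>
    refine sat_ci_confAInterp fun d hd => ?_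
    exact ⟨_, mem_confInterp_pairRole.2 ⟨(mem_confInterp_label.1 hd).1, rfl⟩, trivial⟩
  | dom_push g =>
    refine sat_ci_confAInterp fun d hd => mem_confInterp_exPush.2 ?_
    exact ⟨(mem_confInterp_label.1 hd).1, mem_confInterp_label.2
      ⟨rfl, by simp [Label.Holds, pushConf]⟩⟩
  | init_dom =>
    refine sat_ci_confAInterp fun d hd => mem_confInterp_label.2 ?_
    exact ⟨(mem_confInterp_label.1 hd).1, trivial⟩
  | init_top k =>
    refine sat_ci_confAInterp fun d hd => mem_confInterp_label.2 ?_
    obtain ⟨h₁, h₂⟩ := mem_confInterp_label.1 hd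
    exact ⟨h₁, by simp_all [Label.Holds]⟩
  | top_push g k o hk =>
    refine sat_ci_confAInterp fun d hd => mem_confInterp_exPush.2 ?_
    obtain ⟨h₁, h₂⟩ := mem_confInterp_label.1 hd
    refine ⟨h₁, mem_confInterp_label.2 ⟨rfl, ?_⟩⟩
    simpa [Label.Holds, pushConf, Function.update_of_ne hk.symm] using h₂
  | instr i hi =>
    cases i with
    | push p k a p' =>
      refine sat_ci_confAInterp fun d hd => mem_confInterp_exPush.2 ?_
      obtain ⟨h₁, h₂⟩ := mem_confInterp_label.1 hd
      exact ⟨h₁, mem_confInterp_label.2 ⟨rfl, .push h₂ hi⟩⟩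
    | pop p k a p' =>
      refine sat_ci_confAInterp fun d hd => mem_confInterp_label.2 ?_
      obtain ⟨e, he, hp⟩ := hd
      obtain ⟨h₁, rfl⟩ := mem_confInterp_pushRole.1 he
      exact ⟨h₁, .pop (mem_confInterp_label.1 hp).2 hi⟩
    | test p k o p' =>
      refine sat_ci_confAInterp fun d hd => mem_confInterp_label.2 ?_
      obtain ⟨h₁, h₂⟩ := mem_confInterp_label.1 hd.1
      exact ⟨h₁, .test h₂ hi (mem_confInterp_label.1 hd.2).2⟩
    | jump p p' =>
      refine sat_ci_confAInterp fun d hd => mem_confInterp_label.2 ?_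
      obtain ⟨h₁, h₂⟩ := mem_confInterp_label.1 hd
      exact ⟨h₁, .jump h₂ hi⟩

theorem satisfiable_of_not_reach {P : Set (Instr κ γ Q)} {h p₀ : Q} {k : κ} {w : List γ}
    (hh : ∀ S, ¬ Reach P p₀ (Function.update (fun _ => []) k w) h S) :
    Satisfiable (machineOntology P h, inputConcept p₀ k w, 0) := by
  refine ⟨confAInterp (Reach P p₀ (Function.update (fun _ => []) k w)),
    fun s hs => sat_machineStmt hh (mem_machineOntology.1 hs), by simp [confAInterp],
    (fun _ => [], false), mem_confInterp_label.2 ⟨rfl, rfl⟩, ?_⟩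
  exact mem_confInterp_exPushWord (mem_confInterp_label.2 ⟨rfl, .refl⟩)

end

end AbsDL

namespace AbsDL

open Turing

/-! ### Simulating machines of type `TM2` -/

section
variable {κ γ Λ σ : Type}

/-- The statements of a machine with a finite set `L` of labels. -/
abbrev ProgStmt (M : Λ → TM2.Stmt (fun _ : κ => γ) Λ σ) (L : Finset Λ) : Type :=
  {q // ∃ l ∈ L, q ∈ TM2.stmts₁ (M l)}

variable (M : Λ → TM2.Stmt (fun _ : κ => γ) Λ σ) (L : Finset Λ)

instance : Finite (ProgStmt M L) := by
  refine Set.Finite.subset (s := ⋃ l ∈ L, ↑(TM2.stmts₁ (M l))) ?_ ?_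
  · exact L.finite_toSet.biUnion fun l _ => Finset.finite_toSet _
  · rintro q ⟨l, hl, hq⟩
    simp only [Set.mem_iUnion]
    exact ⟨l, hl, hq⟩

variable {M L}

theorem ProgStmt.sub (q : ProgStmt M L) {q' : TM2.Stmt (fun _ : κ => γ) Λ σ}
    (h : q' ∈ TM2.stmts₁ q.1) : ∃ l ∈ L, q' ∈ TM2.stmts₁ (M l) := by
  obtain ⟨l, hl, hq⟩ := q.2
  exact ⟨l, hl, TM2.stmts₁_trans hq h⟩

/-- The states that simulate `M`: pairs of a statement and a value of the local variable, and
a state `none` for halting. -/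
abbrev ProgState (M : Λ → TM2.Stmt (fun _ : κ => γ) Λ σ) (L : Finset Λ) : Type :=
  Option (ProgStmt M L × σ)

/-- The instructions that simulate `M`. -/
inductive Prog (M : Λ → TM2.Stmt (fun _ : κ => γ) Λ σ) (L : Finset Λ) :
    Instr κ γ (ProgState M L) → Prop
  | push (q q' : ProgStmt M L) (k : κ) (f : σ → γ) (v : σ) : q.1 = .push k f q'.1 →
      Prog M L (.push (some (q, v)) k (f v) (some (q', v)))
  | peek (q q' : ProgStmt M L) (k : κ) (f : σ → Option γ → σ) (v : σ) (o : Option γ) :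
      q.1 = .peek k f q'.1 → Prog M L (.test (some (q, v)) k o (some (q', f v o)))
  | pop_none (q q' : ProgStmt M L) (k : κ) (f : σ → Option γ → σ) (v : σ) :
      q.1 = .pop k f q'.1 → Prog M L (.test (some (q, v)) k none (some (q', f v none)))
  | pop_some (q q' : ProgStmt M L) (k : κ) (f : σ → Option γ → σ) (v : σ) (a : γ) :
      q.1 = .pop k f q'.1 → Prog M L (.pop (some (q, v)) k a (some (q', f v (some a))))
  | load (q q' : ProgStmt M L) (f : σ → σ) (v : σ) :
      q.1 = .load f q'.1 → Prog M L (.jump (some (q, v)) (some (q', f v)))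
  | branch (q q₁ q₂ : ProgStmt M L) (f : σ → Bool) (v : σ) :
      q.1 = .branch f q₁.1 q₂.1 →
      Prog M L (.jump (some (q, v)) (some (cond (f v) q₁ q₂, v)))
  | goto (q q' : ProgStmt M L) (f : σ → Λ) (v : σ) :
      q.1 = .goto f → q'.1 = M (f v) → Prog M L (.jump (some (q, v)) (some (q', v)))
  | halt (q : ProgStmt M L) (v : σ) : q.1 = .halt → Prog M L (.jump (some (q, v)) none)

variable [DecidableEq κ]

/-- Running the statement `q` and then the machine `M` halts. -/
def Halts (M : Λ → TM2.Stmt (fun _ : κ => γ) Λ σ) (q : TM2.Stmt (fun _ : κ => γ) Λ σ) (v : σ)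
    (S : κ → List γ) : Prop :=
  (StateTransition.eval (TM2.step M) (TM2.stepAux q v S)).Dom

/-- Among the statements, only `goto` costs a machine step; `TM2.stepAux` unfolds the others up to a
`goto` or `halt`. -/
theorem halts_goto (f : σ → Λ) (v : σ) (S : κ → List γ) :
    Halts M (.goto f) v S ↔ Halts M (M (f v)) v S := by
  rw [Halts, Halts, StateTransition.reaches_eval (b := TM2.stepAux (M (f v)) v S)]
  exact .single rfl

theorem halts_halt (v : σ) (S : κ → List γ) : Halts M .halt v S :=
  Part.dom_iff_mem.2 ⟨_, StateTransition.mem_eval.2 ⟨.refl, rfl⟩⟩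

/-- A state of the simulation in which the machine halts. -/
def ProgState.Halts (p : ProgState M L) (S : κ → List γ) : Prop :=
  ∀ x ∈ p, AbsDL.Halts M x.1.1 x.2 S

/-- Non-halting is invariant under every instruction, whereas the state `none` counts as halting
vacuously. -/
theorem not_reach_of_not_halts {q : ProgStmt M L} {v : σ} {S₀ S : κ → List γ}
    (h : ¬ Halts M q.1 v S₀) : ¬ Reach {i | Prog M L i} (some (q, v)) S₀ none S := by
  have key (p : ProgState M L) (S) (hr : Reach {i | Prog M L i} (some (q, v)) S₀ p S) :
      ¬ p.Halts S := by
    induction hr with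
    | refl => simpa [ProgState.Halts] using h
    | push _ hi ih =>
      rcases hi with ⟨q, q', k, f, v, hq⟩
      simpa [ProgState.Halts, Halts, hq] using ih
    | pop _ hi ih =>
      rcases hi with _ | _ | _ | ⟨q, q', k, f, v, a, hq⟩
      simpa [ProgState.Halts, Halts, hq] using ih
    | @test _ k _ _ S _ hi ho ih =>
      rcases hi with _ | ⟨q, q', k, f, v, o, hq⟩ | ⟨q, q', _, f, v, hq⟩
      · subst ho
        simpa [ProgState.Halts, Halts, hq] using ih
      · have hS : S k = [] := List.head?_eq_none_iff.1 ho
        -- In `TM2`, popping an empty stack leaves it empty, so a test without a pop simulates it.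
        have hu : Function.update S k [] = S := by rw [← hS, Function.update_eq_self]
        simpa [ProgState.Halts, Halts, hq, hS, hu] using ih
    | jump _ hi ih =>
      rcases hi with _ | _ | _ | _ | ⟨q, q', f, v, hq⟩ | ⟨q, q₁, q₂, f, v, hq⟩ |
        ⟨q, q', f, v, hq, hq'⟩ | ⟨q, v, hq⟩
      · simpa [ProgState.Halts, Halts, hq] using ih
      · cases hf : f v <;> simpa [ProgState.Halts, Halts, hq, hf] using ih
      · simpa [ProgState.Halts, hq, hq', halts_goto] using ih
      · simp [ProgState.Halts, hq, halts_halt] at ih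
  intro hr
  exact key _ _ hr (by simp [ProgState.Halts])

/-- The state of the simulation that corresponds to a configuration. -/
inductive Corr (M : Λ → TM2.Stmt (fun _ : κ => γ) Λ σ) (L : Finset Λ) :
    TM2.Cfg (fun _ : κ => γ) Λ σ → ProgState M L → Prop
  | some (l v S) (q : ProgStmt M L) : q.1 = M l → Corr M L ⟨some l, v, S⟩ (some (q, v))
  | none (v S) : Corr M L ⟨none, v, S⟩ none

/-- One machine step is a chain of instructions, followed by induction on the statement. The support
condition keeps the target of a `goto` in `L`. -/
theorem reach_stepAux (hL : ∀ l ∈ L, TM2.SupportsStmt L (M l)) {p₀ : ProgState M L}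
    {S₀ : κ → List γ} (q : ProgStmt M L) (v : σ) (S : κ → List γ)
    (h : Reach {i | Prog M L i} p₀ S₀ (some (q, v)) S) :
    ∃ p, Corr M L (TM2.stepAux q.1 v S) p ∧
      Reach {i | Prog M L i} p₀ S₀ p (TM2.stepAux q.1 v S).stk := by
  obtain ⟨q, hq⟩ := q
  induction q generalizing v S with
  | push k f q ih =>
    have hq' := ProgStmt.sub ⟨_, hq⟩ (q' := q) (by simp [TM2.stmts₁, TM2.stmts₁_self])
    exact ih _ _ hq' (h.push (.push ⟨_, hq⟩ ⟨q, hq'⟩ k f v rfl))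
  | peek k f q ih =>
    have hq' := ProgStmt.sub ⟨_, hq⟩ (q' := q) (by simp [TM2.stmts₁, TM2.stmts₁_self])
    exact ih _ _ hq' (h.test (.peek ⟨_, hq⟩ ⟨q, hq'⟩ k f v _ rfl) rfl)
  | pop k f q ih =>
    have hq' := ProgStmt.sub ⟨_, hq⟩ (q' := q) (by simp [TM2.stmts₁, TM2.stmts₁_self])
    refine ih _ _ hq' ?_
    cases hS : S k with
    | nil =>
      have hu : Function.update S k [] = S := by rw [← hS, Function.update_eq_self]
      simp only [List.head?_nil, List.tail_nil, hu]
      exact h.test (.pop_none ⟨_, hq⟩ ⟨q, hq'⟩ k f v rfl) (by simp [hS])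
    | cons a l =>
      -- `Reach.pop` presents its source as a push on its target, so `S` has to be recognised as `a`
      -- pushed on the popped stacks.
      refine Reach.pop ?_ (.pop_some ⟨_, hq⟩ ⟨q, hq'⟩ k f v a rfl)
      have hu : Function.update S k (a :: l) = S := by rw [← hS, Function.update_eq_self]
      simpa [hu] using h
  | load f q ih =>
    have hq' := ProgStmt.sub ⟨_, hq⟩ (q' := q) (by simp [TM2.stmts₁, TM2.stmts₁_self])
    exact ih _ _ hq' (h.jump (.load ⟨_, hq⟩ ⟨q, hq'⟩ f v rfl))
  | branch f q₁ q₂ ih₁ ih₂ =>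
    have hq₁ := ProgStmt.sub ⟨_, hq⟩ (q' := q₁) (by simp [TM2.stmts₁, TM2.stmts₁_self])
    have hq₂ := ProgStmt.sub ⟨_, hq⟩ (q' := q₂) (by simp [TM2.stmts₁, TM2.stmts₁_self])
    have h' := h.jump (.branch ⟨_, hq⟩ ⟨q₁, hq₁⟩ ⟨q₂, hq₂⟩ f v rfl)
    simp only [TM2.stepAux]
    cases hf : f v with
    | false => exact ih₂ _ _ hq₂ (by simpa [hf] using h')
    | true => exact ih₁ _ _ hq₁ (by simpa [hf] using h')
  | goto f =>
    obtain ⟨l, hl, hql⟩ := hq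
    have hf : f v ∈ L := TM2.stmts₁_supportsStmt_mono hql (hL l hl) v
    have hq' : ∃ l ∈ L, M (f v) ∈ TM2.stmts₁ (M l) := ⟨_, hf, TM2.stmts₁_self⟩
    exact ⟨_, .some _ _ _ ⟨_, hq'⟩ rfl, h.jump (.goto _ ⟨_, hq'⟩ f v rfl rfl)⟩
  | halt => exact ⟨_, .none _ _, h.jump (.halt _ v rfl)⟩

theorem reach_of_halts (hL : ∀ l ∈ L, TM2.SupportsStmt L (M l)) {q : ProgStmt M L} {v : σ}
    {S₀ : κ → List γ} (h : Halts M q.1 v S₀) :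
    ∃ S, Reach {i | Prog M L i} (some (q, v)) S₀ none S := by
  obtain ⟨c, hmem⟩ := Part.dom_iff_mem.1 h
  obtain ⟨hr, hc⟩ := StateTransition.mem_eval.1 hmem
  have key : ∃ p, Corr M L c p ∧ Reach {i | Prog M L i} (some (q, v)) S₀ p c.stk := by
    clear hc hmem
    induction hr with
    | refl => exact reach_stepAux hL q v S₀ .refl
    | @tail b c _ hbc ih =>
      obtain ⟨p, hp, hr⟩ := ih
      cases hp with
      | none => simp at hbc
      | some l v S q hq =>
        simp only [TM2.step, Option.mem_def, Option.some.injEq] at hbc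
        subst hbc
        rw [← hq]
        exact reach_stepAux hL q v S hr
  obtain ⟨p, hp, hr⟩ := key
  cases hp with
  | none v S => exact ⟨S, hr⟩
  -- A final configuration has no next step, hence no label, so it can only correspond to `none`.
  | some => simp at hc

end

end AbsDL

namespace AbsDL

open Turing Turing.PartrecToTM2

/-! ### The reduction is computable -/

theorem primrec_inf (C : Concept) : Primrec (Concept.inf C) := by
  refine (Primrec.of_equiv_iff Concept.equivNat).1 ?_
  have h : Primrec Concept.equivNat := Primrec.of_equiv
  have h' : Primrec fun D : Concept => 6 * Nat.pair C.toNat (Concept.equivNat D) + 3 :=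
    Primrec.nat_add.comp (Primrec.nat_mul.comp (.const 6)
      (Primrec₂.natPair.comp (.const _) h)) (.const 3)
  exact h'.of_eq fun D => by simp [Concept.equivNat, Concept.toNat]

theorem primrec_ex (R : Role) : Primrec (Concept.ex R) := by
  refine (Primrec.of_equiv_iff Concept.equivNat).1 ?_
  have h : Primrec Concept.equivNat := Primrec.of_equiv
  have h' : Primrec fun D : Concept =>
      6 * Nat.pair (Role.equivNat R) (Concept.equivNat D) + 5 :=
    Primrec.nat_add.comp (Primrec.nat_mul.comp (.const 6)
      (Primrec₂.natPair.comp (.const _) h)) (.const 5)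
  exact h'.of_eq fun D => by simp [Concept.equivNat, Concept.toNat]

section
variable {κ γ Q : Type} [Finite κ] [Finite γ] [Finite Q]

theorem primrec_exPush (g : κ × γ) : Primrec (exPush Q g) :=
  (primrec_ex _).comp (primrec_inf _)

theorem primrec_exPushWord (k : κ) (w : List γ) : Primrec (exPushWord Q k w) := by
  induction w with
  | nil => exact Primrec.id
  | cons a w ih => exact ih.comp (primrec_exPush (k, a))

theorem exPushWord_append (k : κ) (w w' : List γ) (C : Concept) :
    exPushWord Q k (w ++ w') C = exPushWord Q k w' (exPushWord Q k w C) :=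
  List.foldl_append

theorem exPushWord_replicate (k : κ) (a : γ) (m : ℕ) (C : Concept) :
    exPushWord Q k (List.replicate m a) C = (exPush Q (k, a))^[m] C := by
  induction m generalizing C with
  | zero => rfl
  | succ m ih => exact ih _

/-- Only the number of iterations of one fixed primitive recursive map depends on `m`, so no
computation on words over `γ` is needed. -/
theorem primrec_inputConcept (p₀ : Q) (k : κ) (a : γ) (w : List γ) :
    Primrec fun m => inputConcept p₀ k (List.replicate m a ++ w) := by
  have h : Primrec fun m => (exPush Q (k, a))^[m] (Label.state p₀ : Label κ γ Q).concept :=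
    Primrec.nat_iterate (h := fun _ => exPush Q (k, a)) .id (.const _)
      ((primrec_exPush (k, a)).comp (Primrec.snd (α := ℕ) (β := Concept)))
  refine ((primrec_inf (Label.init : Label κ γ Q).concept).comp
    ((primrec_exPushWord (Q := Q) k w).comp h)).of_eq fun m => ?_
  rw [inputConcept, exPushWord_append, exPushWord_replicate]

end

/-! ### Undecidability -/

/-- The decider may diverge outside `D`, but composed with `g` it is total. -/
theorem computablePred_of_not_undecidableOn {α : Type} [Primcodable α] {D P : α → Prop}
    {g : ℕ → α} (hg : Computable g) (hD : ∀ m, D (g m)) (h : ¬ UndecidableOn D P) :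
    ComputablePred fun m => P (g m) := by
  obtain ⟨f, hf, hfD⟩ := not_not.1 h
  choose b hb hbP using fun m => hfD (g m) (hD m)
  have hb' : Computable b :=
    (hf.comp hg).of_eq fun m => Part.eq_some_iff.2 (hb m)
  refine ComputablePred.computable_iff.2 ⟨b, hb', funext fun m => propext ?_⟩
  exact (hbP m).symm

theorem exists_code_not_computablePred :
    ∃ c : ToPartrec.Code, ¬ ComputablePred fun m : ℕ => (c.eval [2 ^ m]).Dom := by
  -- The search takes the logarithm `m` of `x`, then the `m`-th code is run on `0`. Powers of two
  -- are used for the sake of their simple binary form.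
  let f : ℕ →. ℕ := fun x => (Nat.rfind fun m => Part.some (decide (2 ^ m = x))).bind
    fun m => (Denumerable.ofNat Nat.Partrec.Code m).eval 0
  have hpow : Primrec fun m : ℕ => 2 ^ m :=
    (Primrec₂.unpaired'.1 Nat.Primrec.pow).comp (.const 2) .id
  have hf : Partrec f := by
    refine Partrec.bind (Partrec.rfind ?_) ?_
    · have h : PrimrecPred fun p : ℕ × ℕ => 2 ^ p.2 = p.1 :=
        Primrec.eq.comp (hpow.comp .snd) .fst
      exact h.decide.to_comp
    · exact Nat.Partrec.Code.eval_part.comp ((Computable.ofNat _).comp .snd) (.const 0)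
  have hf' (m : ℕ) : f (2 ^ m) = (Denumerable.ofNat Nat.Partrec.Code m).eval 0 := by
    have h : m ∈ Nat.rfind fun n => Part.some (decide (2 ^ n = 2 ^ m)) := by
      refine Nat.mem_rfind.2 ⟨by simp, fun hn => ?_⟩
      simp [hn.ne]
    simp only [f, Part.eq_some_iff.2 h, Part.bind_some]
  obtain ⟨c, hc⟩ := ToPartrec.Code.exists_code (Nat.Partrec'.part_iff₁.2 hf)
  refine ⟨c, fun h => ComputablePred.halting_problem 0 ?_⟩
  obtain ⟨b, hb, hb'⟩ := ComputablePred.computable_iff.1 h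
  refine ComputablePred.computable_iff.2 ⟨_, hb.comp Computable.encode, funext fun d => ?_⟩
  rw [← congrFun hb']
  have := hc ⟨[2 ^ Encodable.encode d], rfl⟩
  simp only at this
  rw [this]
  simp [List.Vector.head, hf']

/-- Binary digits are listed with the least significant first, so the zeros precede the one. -/
theorem trNat_two_pow (m : ℕ) : trNat (2 ^ m) = List.replicate m Γ'.bit0 ++ [Γ'.bit1] := by
  have h₁ : ((PosNum.bit0^[m] .one : PosNum) : ℕ) = 2 ^ m := by
    induction m with
    | zero => rfl
    | succ m ih =>
      rw [Function.iterate_succ_apply', PosNum.cast_bit0, ih]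
      ring
  rw [trNat, ← h₁, PosNum.of_to_nat, trNum]
  clear h₁
  induction m with
  | zero => rfl
  | succ m ih => rw [Function.iterate_succ_apply', trPosNum, ih]; rfl

instance : Fintype K' where
  elems := {.main, .rev, .aux, .stack}
  complete k := by cases k <;> simp

/-- Halting is the complement of satisfiability along a computable family of inputs whose ontology
does not depend on `m`. -/
theorem undecidableOn_satisfiable_of_not_computablePred {κ γ Λ σ : Type} [Fintype κ]
    [DecidableEq κ] [Finite γ] [Finite σ] {M : Λ → TM2.Stmt (fun _ : κ => γ) Λ σ} {L : Finset Λ}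
    (hL : ∀ l ∈ L, TM2.SupportsStmt L (M l)) (q : ProgStmt M L) (v : σ) (k : κ) (a : γ)
    (w : List γ) (hM : ¬ ComputablePred fun m =>
      Halts M q.1 v (Function.update (fun _ => []) k (List.replicate m a ++ w)))
    (F : Fragment) (hF : ∀ C : Concept, C.IsEL → F.concept C) (hca : F.hasCA) :
    UndecidableOn F.IsInput Satisfiable := by
  by_contra hdec
  let p : ProgState M L := some (q, v)
  have hg : Computable fun m => ((machineOntology {i | Prog M L i} none,
      inputConcept p k (List.replicate m a ++ w), 0) : Input) :=
    ((Primrec.const _).pair ((primrec_inputConcept _ _ _ _).pair (.const 0))).to_comp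
  have hD m := isInput_machineOntology {i | Prog M L i} none p k (List.replicate m a ++ w) F hF hca
  refine hM ((computablePred_of_not_undecidableOn hg hD hdec).not.of_eq fun m => ⟨?_, ?_⟩)
  · intro h
    by_contra h'
    exact h (satisfiable_of_not_reach fun S => not_reach_of_not_halts h')
  · intro h hsat
    obtain ⟨S, hS⟩ := reach_of_halts hL h
    exact not_reach_of_satisfiable hsat S hS

theorem undecidableOn_satisfiable (F : Fragment) (hF : ∀ C : Concept, C.IsEL → F.concept C)
    (hca : F.hasCA) : UndecidableOn F.IsInput Satisfiable := by
  obtain ⟨c, hc⟩ := exists_code_not_computablePred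
  -- The program `tr` has infinitely many labels; `codeSupp c .halt` is a finite set of them that
  -- supports the run. On the main stack, `.cons` terminates the single entry `2 ^ m`.
  refine undecidableOn_satisfiable_of_not_computablePred (M := tr) (L := codeSupp c .halt)
    (tr_supports c .halt).2
    ⟨tr (trNormal c .halt), _, codeSupp_self _ _ (trStmts₁_self _), TM2.stmts₁_self⟩
    none K'.main .bit0 [.bit1, .cons] (fun h => hc (h.of_eq fun m => ?_)) F hF hca
  have h₁ : (init c [2 ^ m]).stk =
      Function.update (fun _ => []) K'.main (List.replicate m .bit0 ++ [.bit1, .cons]) := by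
    funext k
    cases k <;> simp [init, trNat_two_pow]
  have h₂ : (c.eval [2 ^ m]).Dom ↔ (StateTransition.eval (TM2.step tr) (init c [2 ^ m])).Dom := by
    rw [tr_eval]; rfl
  -- `Halts` starts from a statement rather than a label, one machine step after `init`.
  have h₃ : StateTransition.eval (TM2.step tr) (init c [2 ^ m]) =
      StateTransition.eval (TM2.step tr)
        (TM2.stepAux (tr (trNormal c .halt)) none (init c [2 ^ m]).stk) :=
    StateTransition.reaches_eval (.single rfl)
  rw [h₂, ← h₁, h₃]
  rfl

end AbsDL

theorem theorem8 :
    AbsDL.UndecidableOn AbsDL.ALCI_ca_cr.IsInput AbsDL.Satisfiable ∧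
      AbsDL.UndecidableOn AbsDL.EL_ca_cr_rr.IsInput AbsDL.Satisfiable :=
  ⟨AbsDL.undecidableOn_satisfiable _ (fun _ _ => trivial) trivial,
    AbsDL.undecidableOn_satisfiable _ (fun _ h => h) trivial⟩
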